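/- Let $(\Omega,\mathcal F,\mathbb P)$ be a probability space and consider $L^\infty=L^\infty(\Omega,\mathcal F,\mathbb P)$ with its almost-sure order; write $X^-=\max(-X,0)$. A net $(X_\alpha)\subset L^\infty$ converges in order to $X\in L^\infty$ if there is a net $(Y_\beta)\subset L^\infty$, possibly over another directed index set, that is decreasing with $\inf_\beta Y_\beta=0$ and such that for every $\beta$ there is $\alpha_0$ with $|X_\alpha-X|\le Y_\beta$ for all $\alpha\ge\alpha_0$; it converges in unbounded order to $X$ if $|X_\alpha-X|\wedge Y$ converges in order to $0$ for every $Y\in L^\infty$ with $Y\ge0$. (For sequences in $L^\infty$ these amount to norm-bounded almost-sure convergence and to almost-sure convergence, respectively.) Let $\rho:L^\infty\to\mathbb R\cup\{\infty\}$ be monotone, that is, $X\ge Y$ implies $\rho(X)\le\rho(Y)$, and assume that one of the following holds: (i) $\rho$ is quasiconvex, that is, $\rho(\lambda X+(1-\lambda)Y)\le\max(\rho(X),\rho(Y))$ for all $X,Y\in L^\infty$ and $\lambda\in[0,1]$, and surplus invariant, that is, $\rho(X)=\rho(-X^-)$ for all $X\in L^\infty$; (ii) $\rho$ is convex; it is surplus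 invariant subject to positivity, that is, $\rho(X)=\rho(-X^-)$ for all $X\in L^\infty$ with $\rho(X)>0$; and it is $S$-additive for some $S\in L^\infty$ with $S\ge0$ and $S\ne0$, that is, $\rho(X+mS)=\rho(X)-m$ for all $X\in L^\infty$ and $m\in\mathbb R$. Then the following statements are equivalent: (a) $\rho$ has the Fatou property: $\rho(X)\le\liminf_\alpha\rho(X_\alpha)$ for every net $(X_\alpha)$ in $L^\infty$ that converges in order to $X\in L^\infty$. (b) $\rho$ has the super Fatou property: $\rho(X)\le\liminf_\alpha\rho(X_\alpha)$ for every net $(X_\alpha)$ in $L^\infty$ that converges in unbounded order to $X\in L^\infty$. (c) $\rho$ is lower semicontinuous for $\sigma(L^\infty,L^1)$, the topology on $L^\infty$ generated by the functionals $X\mapsto\mathbb E[XY]$ with $Y\in L^1$. (d) $\rho$ is lower semicontinuous for $\sigma(L^\infty,L^\infty)$, the topology on $L^\infty$ generated by the functionals $X\mapsto\mathbb E[XY]$ with $Y\in L^\infty$. -/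

import Mathlib

open MeasureTheory Filter
open scoped ENNReal

universe u v

namespace RiskFunctional

section VectorLattice

variable {E : Type u} [Lattice E] [AddCommGroup E]

/-- Order convergence of a net `x` to `a`: some net `y` (over a possibly different directed index
set) decreases to `0`, and every `y b` eventually dominates `|x i - a|`. Index sets in the universe
of `E` are enough for `y`, since a decreasing net can be replaced by its range. -/
def OrderTendsto {ι : Type v} [Preorder ι] (x : ι → E) (a : E) : Prop :=
  ∃ (β : Type u) (_ : Preorder β) (_ : IsDirectedOrder β) (_ : Nonempty β) (y : β → E),
    Antitone y ∧ IsGLB (Set.range y) 0 ∧ ∀ b, ∃ i₀, ∀ i, i₀ ≤ i → |x i - a| ≤ y b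

/-- Unbounded-order convergence of a net. -/
def UOTendsto {ι : Type v} [Preorder ι] (x : ι → E) (a : E) : Prop :=
  ∀ y : E, 0 ≤ y → OrderTendsto (fun i => |x i - a| ⊓ y) 0

/-- The Fatou property: lower semicontinuity along order-convergent nets. -/
def FatouProperty (ρ : E → EReal) : Prop :=
  ∀ (ι : Type v) [Preorder ι] [IsDirectedOrder ι] [Nonempty ι] (x : ι → E) (a : E),
    OrderTendsto x a → ρ a ≤ liminf (fun i => ρ (x i)) atTop

/-- The super Fatou property: lower semicontinuity along unbounded-order-convergent nets. -/
def SuperFatouProperty (ρ : E → EReal) : Prop :=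
  ∀ (ι : Type v) [Preorder ι] [IsDirectedOrder ι] [Nonempty ι] (x : ι → E) (a : E),
    UOTendsto x a → ρ a ≤ liminf (fun i => ρ (x i)) atTop

/-- `ρ(X) = ρ(-X⁻)` for all `X`. -/
def SurplusInvariant (ρ : E → EReal) : Prop :=
  ∀ x, ρ x = ρ (-x⁻)

/-- `ρ(X) = ρ(-X⁻)` for all `X` with `ρ(X) > 0`. -/
def SurplusInvariantSubjectToPositivity (ρ : E → EReal) : Prop :=
  ∀ x, 0 < ρ x → ρ x = ρ (-x⁻)

end VectorLattice

section VectorSpace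

variable {E : Type u} [AddCommGroup E] [Module ℝ E]

/-- Convexity of an extended-real functional (used for functionals that avoid `-∞`, with the
convention `0 * ∞ = 0`). -/
def IsConvex (ρ : E → EReal) : Prop :=
  ∀ (x y : E) (l : ℝ), 0 ≤ l → l ≤ 1 →
    ρ (l • x + (1 - l) • y) ≤ (l : EReal) * ρ x + ((1 - l : ℝ) : EReal) * ρ y

/-- `ρ(X + m S) = ρ(X) - m`. -/
def SAdditive (S : E) (ρ : E → EReal) : Prop :=
  ∀ (x : E) (m : ℝ), ρ (x + m • S) = ρ x - (m : EReal)

end VectorSpace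

/-- The topology `σ(L^∞, L^q)` on `L^∞(P)`, generated by the functionals `X ↦ E[X Y]`, `Y ∈ L^q(P)`.
It is used for a probability measure `P` and `1 ≤ q`, where all these integrals converge. -/
@[reducible] noncomputable def weakTopology {Ω : Type u} [MeasurableSpace Ω] (P : Measure Ω) (q : ℝ≥0∞) :
    TopologicalSpace (Lp ℝ ∞ P) :=
  ⨅ Y : Lp ℝ q P, TopologicalSpace.induced (fun X : Lp ℝ ∞ P => ∫ ω, X ω * Y ω ∂P) inferInstance

/-- Lower semicontinuity with respect to `σ(L^∞, L^q)`. -/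
def WeakLowerSemicontinuous {Ω : Type u} [MeasurableSpace Ω] (P : Measure Ω) (q : ℝ≥0∞)
    (ρ : Lp ℝ ∞ P → EReal) : Prop :=
  @LowerSemicontinuous (Lp ℝ ∞ P) EReal (weakTopology P q) _ ρ

end RiskFunctional

namespace RiskFunctional

/-! For a monotone surplus invariant `ρ`, replacing `x` by `-(x⁻ ⊓ a⁻)` does not increase `ρ`, and
turns unbounded order convergence `x → a` into order convergence to `-a⁻`, where `ρ` has the value
`ρ a`. Thus Fatou implies super Fatou. The same truncation makes an almost surely convergent
subsequence of an `L^1`-convergent sequence dominated, so Fatou makes the sublevel sets relatively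
`L^1`-closed. They are convex, and Hahn–Banach in `L^1`, whose dual functionals are bounded random
variables, makes them `σ(L^∞, L^∞)`-closed.

In case (ii) the argument applies to `ρ ⊔ 0`, which is quasiconvex and surplus invariant;
`S`-additivity carries the result back to `ρ` (`SAdditive.lt_iff`). The remaining implications
compare topologies and use that order convergence implies weak convergence. -/

theorem le_liminf_of_forall_real_lt {ι : Type v} {l : Filter ι} {b : EReal} {u : ι → EReal}
    (h : ∀ r : ℝ, (r : EReal) < b → ∀ᶠ i in l, (r : EReal) < u i) : b ≤ liminf u l := by
  refine le_of_forall_lt fun c hc => ?_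
  obtain ⟨q, hcq, hqb⟩ := EReal.lt_iff_exists_real_btwn.1 hc
  refine hcq.trans_le ?_
  exact le_liminf_of_le (by isBoundedDefault) ((h q hqb).mono fun i hi => hi.le)

/-- Shifting along `S` moves every level `r` to level `0`, so the positive part alone determines all
strict superlevel sets of `ρ`. -/
theorem SAdditive.lt_iff {E : Type u} [AddCommGroup E] [Module ℝ E] {S : E} {ρ : E → EReal}
    (h : SAdditive S ρ) (x : E) (r : ℝ) :
    (r : EReal) < ρ x ↔ (0 : EReal) < (ρ ⊔ 0) (x + r • S) := by
  rw [Pi.sup_apply, Pi.zero_apply, lt_sup_iff, h x r]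
  simp only [lt_irrefl, or_false]
  exact EReal.sub_pos.symm

/-! ### Truncation and Fatou properties in vector lattices -/

section VectorLattice

variable {E : Type u} [Lattice E] [AddCommGroup E]

theorem FatouProperty.sup_zero {ρ : E → EReal} (h : FatouProperty.{u, v} ρ) :
    FatouProperty.{u, v} (ρ ⊔ 0) := by
  intro ι _ _ _ x a hx
  refine le_liminf_of_forall_real_lt fun r hr => ?_
  rcases lt_sup_iff.1 hr with hr | hr
  · have := hr.trans_le (h ι x a hx)
    filter_upwards [eventually_lt_of_lt_liminf this] with i hi
    exact lt_sup_of_lt_left hi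
  · exact Eventually.of_forall fun i => lt_sup_of_lt_right hr

theorem UOTendsto.add_const {ι : Type v} [Preorder ι] {x : ι → E} {a : E}
    (h : UOTendsto x a) (c : E) : UOTendsto (fun i => x i + c) (a + c) := by
  simpa only [UOTendsto, add_sub_add_right_eq_sub] using h

theorem SAdditive.superFatouProperty [Module ℝ E] {S : E} {ρ : E → EReal} (h : SAdditive S ρ)
    (hf : SuperFatouProperty.{u, v} (ρ ⊔ 0)) : SuperFatouProperty.{u, v} ρ := by
  intro ι _ _ _ x a hx
  refine le_liminf_of_forall_real_lt fun r hr => ?_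
  have := ((h.lt_iff a r).1 hr).trans_le (hf ι _ _ (hx.add_const (r • S)))
  filter_upwards [eventually_lt_of_lt_liminf this] with i hi
  exact (h.lt_iff _ r).2 hi

section OrderedGroup

variable [IsOrderedAddMonoid E]

theorem OrderTendsto.uoTendsto {ι : Type v} [Preorder ι] {x : ι → E} {a : E}
    (h : OrderTendsto x a) : UOTendsto x a := by
  intro z hz
  obtain ⟨β, h1, h2, h3, y, hy, hglb, hdom⟩ := h
  refine ⟨β, h1, h2, h3, y, hy, hglb, fun b => ?_⟩
  obtain ⟨i₀, hi₀⟩ := hdom b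
  refine ⟨i₀, fun i hi => ?_⟩
  rw [sub_zero, abs_of_nonneg (le_inf (abs_nonneg _) hz)]
  exact inf_le_left.trans (hi₀ i hi)

theorem SuperFatouProperty.fatouProperty {ρ : E → EReal}
    (h : SuperFatouProperty.{u, v} ρ) : FatouProperty.{u, v} ρ :=
  fun ι _ _ _ x a hx => h ι x a hx.uoTendsto

theorem abs_negPart_sub_negPart_le (a b : E) : |a⁻ - b⁻| ≤ |a - b| := by
  have h := abs_sup_sub_sup_le_abs (-a) (-b) 0
  rwa [← negPart_def, ← negPart_def, neg_sub_neg, abs_sub_comm b a] at h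

/-- Lattice operations are nonexpansive, which gives the first bound; the second holds because `a⁻ ⊓
b⁻` lies between `0` and `b⁻`. -/
theorem abs_neg_negPart_inf_sub_le (a b : E) :
    |(-(a⁻ ⊓ b⁻)) - (-b⁻)| ≤ |a - b| ⊓ b⁻ := by
  have hab : |(-(a⁻ ⊓ b⁻)) - (-b⁻)| = |b⁻ - a⁻ ⊓ b⁻| := by congr 1; abel
  rw [hab]
  refine le_inf ?_ ?_
  · have h := abs_inf_sub_inf_le_abs a⁻ b⁻ b⁻
    rw [inf_idem, abs_sub_comm] at h
    exact h.trans (abs_negPart_sub_negPart_le a b)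
  · rw [abs_of_nonneg (sub_nonneg.2 inf_le_right)]
    exact sub_le_self _ (le_inf (negPart_nonneg a) (negPart_nonneg b))

theorem UOTendsto.neg_negPart_inf {ι : Type v} [Preorder ι] {x : ι → E} {a : E}
    (h : UOTendsto x a) : OrderTendsto (fun i => -((x i)⁻ ⊓ a⁻)) (-a⁻) := by
  obtain ⟨β, h1, h2, h3, y, hy, hglb, hdom⟩ := h a⁻ (negPart_nonneg a)
  refine ⟨β, h1, h2, h3, y, hy, hglb, fun b => ?_⟩
  obtain ⟨i₀, hi₀⟩ := hdom b
  refine ⟨i₀, fun i hi => (abs_neg_negPart_inf_sub_le (x i) a).trans ?_⟩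
  have := hi₀ i hi
  rw [sub_zero] at this
  exact (le_abs_self _).trans this

theorem SurplusInvariant.le_of_antitone {ρ : E → EReal} (hs : SurplusInvariant ρ)
    (ha : Antitone ρ) (x z : E) : ρ (-(x⁻ ⊓ z)) ≤ ρ x := by
  rw [hs x]
  exact ha (neg_le_neg inf_le_left)

theorem FatouProperty.superFatouProperty {ρ : E → EReal} (hs : SurplusInvariant ρ)
    (ha : Antitone ρ) (h : FatouProperty.{u, v} ρ) : SuperFatouProperty.{u, v} ρ := by
  intro ι _ _ _ x a hx
  rw [hs a]
  refine (h ι _ _ hx.neg_negPart_inf).trans ?_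
  exact liminf_le_liminf (Eventually.of_forall fun i => hs.le_of_antitone ha (x i) a⁻)

section Module

variable [Module ℝ E]

/-- Surplus invariance subject to positivity and `S`-additivity make the positive part of a
monotone functional surplus invariant. -/
theorem SurplusInvariantSubjectToPositivity.surplusInvariant_sup_zero {S : E} {ρ : E → EReal}
    (hs : SurplusInvariantSubjectToPositivity ρ) (ha : Antitone ρ) (hbot : ∀ x, ρ x ≠ ⊥)
    (hS : ∀ m : ℝ, 0 ≤ m → 0 ≤ m • S) (h : SAdditive S ρ) : SurplusInvariant (ρ ⊔ 0) := by
  intro x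
  simp only [Pi.sup_apply, Pi.zero_apply]
  rcases lt_or_ge 0 (ρ x) with hx | hx
  · rw [← hs x hx]
  rw [sup_eq_right.2 hx, eq_comm, sup_eq_right]
  refine EReal.le_of_forall_lt_iff_le.1 fun ε hε => ?_
  lift ρ x to ℝ using ⟨fun h => by simp [h] at hx, hbot x⟩ with t ht
  have hε' : 0 < ε := EReal.coe_pos.1 hε
  have ht' : t ≤ 0 := EReal.coe_nonpos.1 hx
  -- The shift is chosen to raise the value from `t ≤ 0` to exactly `ε > 0`, where surplus
  -- invariance is available; monotonicity then bounds `ρ (-x⁻)` by `ε`.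
  have key : ρ (x + (t - ε) • S) = ε := by
    rw [h, ← ht, ← EReal.coe_sub]
    congr 1
    ring
  have hle : x + (t - ε) • S ≤ x := by
    have := hS (ε - t) (by linarith)
    rw [← neg_sub ε t, neg_smul, ← sub_eq_add_neg]
    exact sub_le_self _ this
  have hpos : 0 < ρ (x + (t - ε) • S) := key ▸ hε
  rw [← key, hs _ hpos]
  exact ha (neg_le_neg (negPart_anti hle))

end Module

end OrderedGroup

end VectorLattice

/-! ### Quasiconvexity -/

theorem IsConvex.quasiconvexOn {E : Type u} [AddCommGroup E] [Module ℝ E] {ρ : E → EReal}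
    (h : IsConvex ρ) (hbot : ∀ x, ρ x ≠ ⊥) : QuasiconvexOn ℝ Set.univ ρ := by
  rw [quasiconvexOn_iff_le_max]
  refine ⟨convex_univ, fun x _ y _ a b ha hb hab => ?_⟩
  obtain rfl : b = 1 - a := by linarith
  refine (h x y a ha (by linarith)).trans ?_
  have hle : ∀ r : EReal, r ≠ ⊥ → ρ x ≤ r → ρ y ≤ r →
      (a : EReal) * ρ x + ((1 - a : ℝ) : EReal) * ρ y ≤ r := by
    intro r hr hx hy
    induction r with
    | bot => exact absurd rfl hr
    | top => exact le_top
    | coe r =>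
      calc (a : EReal) * ρ x + ((1 - a : ℝ) : EReal) * ρ y
          ≤ (a : EReal) * r + ((1 - a : ℝ) : EReal) * r :=
            add_le_add (mul_le_mul_of_nonneg_left hx (EReal.coe_nonneg.2 ha))
              (mul_le_mul_of_nonneg_left hy (EReal.coe_nonneg.2 hb))
        _ = r := by
          rw [← EReal.coe_mul, ← EReal.coe_mul, ← EReal.coe_add]
          congr 1
          ring
  refine hle _ (fun h => ?_) (le_max_left _ _) (le_max_right _ _)
  exact hbot x (le_bot_iff.1 (h ▸ le_max_left (ρ x) (ρ y)))

theorem quasiconvexOn_sup_zero {E : Type u} [AddCommGroup E] [Module ℝ E] {ρ : E → EReal}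
    (h : QuasiconvexOn ℝ Set.univ ρ) : QuasiconvexOn ℝ Set.univ (ρ ⊔ 0) := by
  refine h.sup fun r => ?_
  by_cases hr : (0 : EReal) ≤ r
  · simpa [hr] using convex_univ
  · simpa [hr] using convex_empty

/-! ### Order convergence and weak topologies on `L^∞` -/

section Lebesgue

variable {Ω : Type u} [MeasurableSpace Ω] {P : Measure Ω}

theorem integrable_mul_of_Lp_top [IsFiniteMeasure P] {q : ℝ≥0∞} (hq : 1 ≤ q) (X : Lp ℝ ∞ P)
    (Y : Lp ℝ q P) : Integrable (fun ω => X ω * Y ω) P :=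
  (((Lp.memLp Y).mono_exponent hq).integrable le_rfl).mul_of_top_right (Lp.memLp X)

/-- A dominated sequence in `L^∞` that converges almost surely converges in order. -/
theorem orderTendsto_of_tendsto_ae {x : ℕ → Lp ℝ ∞ P} {a w : Lp ℝ ∞ P}
    (hw : ∀ n, |x n - a| ≤ w)
    (h : ∀ᵐ ω ∂P, Tendsto (fun n => x n ω) atTop (nhds (a ω))) :
    OrderTendsto (fun i : ULift.{v} ℕ => x i.down) a := by
  have hbd : ∀ᵐ ω ∂P, ∀ n, |x n ω - a ω| ≤ w ω := by
    refine ae_all_iff.2 fun n => ?_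
    filter_upwards [(Lp.coeFn_le _ _).2 (hw n), Lp.coeFn_abs (x n - a), Lp.coeFn_sub (x n) a]
      with ω h1 h2 h3
    rwa [h2, h3] at h1
  have hbdd : ∀ᵐ ω ∂P, ∀ n, BddAbove (Set.range fun k => |x (n + k) ω - a ω|) := by
    filter_upwards [hbd] with ω hω n
    exact ⟨w ω, by rintro _ ⟨k, rfl⟩; exact hω _⟩
  -- The tail suprema of the errors are the decreasing dominating net.
  let g : ℕ → Ω → ℝ := fun n ω => ⨆ k, |x (n + k) ω - a ω|
  have hg : ∀ n, MemLp (g n) ∞ P := by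
    intro n
    refine (Lp.memLp w).mono ?_ ?_
    · refine AEMeasurable.aestronglyMeasurable (AEMeasurable.iSup fun k => ?_)
      exact ((Lp.aestronglyMeasurable (x (n + k))).sub
        (Lp.aestronglyMeasurable a)).norm.aemeasurable
    · filter_upwards [hbd] with ω hω
      rw [Real.norm_of_nonneg (Real.iSup_nonneg fun k => abs_nonneg _)]
      exact (ciSup_le fun k => hω _).trans (le_abs_self _)
  have hlim : ∀ᵐ ω ∂P, Tendsto (fun n => g n ω) atTop (nhds 0) := by
    filter_upwards [h, hbdd] with ω hω hb
    rw [Metric.tendsto_atTop] at hω ⊢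
    intro ε hε
    obtain ⟨N, hN⟩ := hω (ε / 2) (half_pos hε)
    refine ⟨N, fun n hn => ?_⟩
    rw [Real.dist_0_eq_abs, abs_of_nonneg (Real.iSup_nonneg fun k => abs_nonneg _)]
    refine lt_of_le_of_lt (ciSup_le fun k => ?_) (half_lt_self hε)
    exact (hN (n + k) (by omega)).le
  have hcoe : ∀ᵐ ω ∂P, ∀ n, (hg n).toLp (g n) ω = g n ω :=
    ae_all_iff.2 fun n => (hg n).coeFn_toLp
  refine ⟨ULift.{u} ℕ, inferInstance, ⟨fun i j => ⟨⟨max i.down j.down⟩,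
    le_max_left i.down j.down, le_max_right i.down j.down⟩⟩, inferInstance,
    fun i => (hg i.down).toLp (g i.down), ?_, ⟨?_, ?_⟩, ?_⟩
  · intro i j hij
    rw [← Lp.coeFn_le]
    filter_upwards [hcoe, hbdd] with ω hω hb
    rw [hω, hω]
    refine ciSup_le fun k => ?_
    have hij' : i.down ≤ j.down := hij
    have := le_ciSup (hb i.down) (j.down - i.down + k)
    simpa only [← add_assoc, Nat.add_sub_cancel' hij'] using this
  · rintro _ ⟨i, rfl⟩
    rw [← Lp.coeFn_nonneg]
    filter_upwards [hcoe] with ω hω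
    rw [hω]
    exact Real.iSup_nonneg fun k => abs_nonneg _
  · intro z hz
    have hz' : ∀ᵐ ω ∂P, ∀ n : ℕ, z ω ≤ (hg n).toLp (g n) ω :=
      ae_all_iff.2 fun n => (Lp.coeFn_le _ _).2 (hz ⟨⟨n⟩, rfl⟩)
    rw [← Lp.coeFn_le]
    filter_upwards [hz', hcoe, hlim, Lp.coeFn_zero ℝ ∞ P] with ω h1 h2 h3 h4
    rw [h4]
    exact ge_of_tendsto' h3 fun n => (h2 n) ▸ h1 n
  · intro b
    refine ⟨⟨b.down⟩, fun i hi => ?_⟩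
    have hi' : b.down ≤ i.down := hi
    rw [← Lp.coeFn_le]
    filter_upwards [hcoe, hbdd, Lp.coeFn_abs (x i.down - a), Lp.coeFn_sub (x i.down) a]
      with ω h1 h2 h3 h4
    rw [h1, h3, h4, Pi.sub_apply]
    have := le_ciSup (h2 b.down) (i.down - b.down)
    rwa [Nat.add_sub_cancel' hi'] at this

theorem exists_monotone_seq_ge {β : Type u} [Preorder β] [IsDirectedOrder β] (c : ℕ → β) :
    ∃ b : ℕ → β, Monotone b ∧ ∀ n, c n ≤ b n := by
  choose m hm1 hm2 using fun i j : β => exists_ge_ge i j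
  let b : ℕ → β := fun n => Nat.rec (c 0) (fun k r => m r (c (k + 1))) n
  refine ⟨b, monotone_nat_of_le_succ fun n => hm1 _ _, fun n => ?_⟩
  cases n with
  | zero => exact le_rfl
  | succ k => exact hm2 _ _

/-- A net in `L^∞` that decreases to `0` contains a sequence decreasing to `0` almost surely. -/
theorem exists_seq_tendsto_zero_of_isGLB [IsFiniteMeasure P] {β : Type v} [Preorder β]
    [IsDirectedOrder β] [Nonempty β] {y : β → Lp ℝ ∞ P} (hy : Antitone y)
    (hglb : IsGLB (Set.range y) 0) :
    ∃ b : ℕ → β, Monotone b ∧ ∀ᵐ ω ∂P, Tendsto (fun n => y (b n) ω) atTop (nhds 0) := by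
  have hint : ∀ X : Lp ℝ ∞ P, Integrable X P := fun X => (Lp.memLp X).integrable le_top
  have hnn : ∀ b, 0 ≤ᵐ[P] y b := fun b => (Lp.coeFn_nonneg _).2 (hglb.1 ⟨b, rfl⟩)
  have hbb : BddBelow (Set.range fun b => ∫ ω, y b ω ∂P) :=
    ⟨0, by rintro _ ⟨b, rfl⟩; exact integral_nonneg_of_ae (hnn b)⟩
  -- The sequence nearly minimizes the expectation over the net.
  have hc : ∀ n : ℕ, ∃ c, ∫ ω, y c ω ∂P < (⨅ b, ∫ ω, y b ω ∂P) + 1 / ((n : ℝ) + 1) :=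
    fun n => exists_lt_of_ciInf_lt (lt_add_of_pos_right _ Nat.one_div_pos_of_nat)
  choose c hc using hc
  obtain ⟨b, hb, hcb⟩ := exists_monotone_seq_ge c
  refine ⟨b, hb, ?_⟩
  have hnn' : ∀ᵐ ω ∂P, ∀ n, 0 ≤ y (b n) ω := ae_all_iff.2 fun n => hnn (b n)
  have hanti : ∀ᵐ ω ∂P, Antitone fun n => y (b n) ω := by
    have : ∀ᵐ ω ∂P, ∀ n, y (b (n + 1)) ω ≤ y (b n) ω :=
      ae_all_iff.2 fun n => (Lp.coeFn_le _ _).2 (hy (hb n.le_succ))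
    filter_upwards [this] with ω hω
    exact antitone_nat_of_succ_le hω
  let g : Ω → ℝ := fun ω => ⨅ n, y (b n) ω
  have hgle : ∀ᵐ ω ∂P, ∀ n, g ω ≤ y (b n) ω := by
    filter_upwards [hnn'] with ω hω n
    exact ciInf_le ⟨0, by rintro _ ⟨k, rfl⟩; exact hω k⟩ n
  have hg : MemLp g ∞ P := by
    refine (Lp.memLp (y (b 0))).mono ?_ ?_
    · exact AEMeasurable.aestronglyMeasurable
        (AEMeasurable.iInf fun n => (Lp.aestronglyMeasurable (y (b n))).aemeasurable)
    · filter_upwards [hnn', hgle] with ω h1 h2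
      rw [Real.norm_of_nonneg (Real.iInf_nonneg h1), Real.norm_of_nonneg (h1 0)]
      exact h2 0
  -- The infimum `g` of the sequence bounds the whole net below: for `e` above `b n` and `d`, the
  -- expectation of `(g - y d)⁺` is at most the drop from `y (b n)` to `y e`, hence at most `1 / (n
  -- + 1)`.
  have hlower : hg.toLp g ≤ 0 := by
    refine hglb.2 ?_
    rintro _ ⟨d, rfl⟩
    have hpos : Integrable (fun ω => max (g ω - y d ω) 0) P :=
      ((hg.integrable le_top).sub (hint (y d))).pos_part
    have hsmall : ∀ n : ℕ, ∫ ω, max (g ω - y d ω) 0 ∂P ≤ 1 / ((n : ℝ) + 1) := by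
      intro n
      obtain ⟨e, hbe, hde⟩ := exists_ge_ge (b n) d
      have h1 : ∫ ω, max (g ω - y d ω) 0 ∂P ≤ ∫ ω, (y (b n) ω - y e ω) ∂P := by
        refine integral_mono_ae hpos ((hint _).sub (hint _)) ?_
        filter_upwards [hgle, (Lp.coeFn_le _ _).2 (hy hbe), (Lp.coeFn_le _ _).2 (hy hde)]
          with ω h1 h2 h3
        exact max_le (sub_le_sub (h1 n) h3) (sub_nonneg.2 h2)
      rw [integral_sub (hint _) (hint _)] at h1
      have h2 := ciInf_le hbb e
      have h3 : ∫ ω, y (b n) ω ∂P ≤ ∫ ω, y (c n) ω ∂P :=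
        integral_mono_ae (hint _) (hint _) ((Lp.coeFn_le _ _).2 (hy (hcb n)))
      have h4 := hc n
      linarith
    have hzero : ∫ ω, max (g ω - y d ω) 0 ∂P = 0 :=
      le_antisymm (ge_of_tendsto' tendsto_one_div_add_atTop_nhds_zero_nat hsmall)
        (integral_nonneg fun ω => le_max_right _ _)
    have hzero' := (integral_eq_zero_iff_of_nonneg (fun ω => le_max_right _ _) hpos).1 hzero
    rw [← Lp.coeFn_le]
    filter_upwards [hzero', hg.coeFn_toLp] with ω h1 h2
    rw [h2]
    exact sub_nonpos.1 ((le_max_left _ _).trans h1.le)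
  filter_upwards [(Lp.coeFn_le _ _).2 hlower, hg.coeFn_toLp, Lp.coeFn_zero ℝ ∞ P, hnn', hanti]
    with ω h1 h2 h3 h4 h5
  have hlim := tendsto_atTop_ciInf h5 ⟨0, by rintro _ ⟨k, rfl⟩; exact h4 k⟩
  rw [h2, h3] at h1
  rwa [show (⨅ n, y (b n) ω) = 0 from le_antisymm h1 (Real.iInf_nonneg h4)] at hlim

/-- Dominated convergence fails for general nets, so it is applied to a sequence extracted from the
dominating net. -/
theorem OrderTendsto.tendsto_integral_mul [IsFiniteMeasure P] {q : ℝ≥0∞} (hq : 1 ≤ q)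
    {ι : Type v} [Preorder ι] [IsDirectedOrder ι] [Nonempty ι] {x : ι → Lp ℝ ∞ P}
    {a : Lp ℝ ∞ P} (h : OrderTendsto x a) (Y : Lp ℝ q P) :
    Tendsto (fun i => ∫ ω, x i ω * Y ω ∂P) atTop (nhds (∫ ω, a ω * Y ω ∂P)) := by
  obtain ⟨β, _, _, _, y, hy, hglb, hdom⟩ := h
  obtain ⟨b, hb, hlim⟩ := exists_seq_tendsto_zero_of_isGLB hy hglb
  have hint : ∀ X : Lp ℝ ∞ P, Integrable (fun ω => X ω * |Y ω|) P := fun X =>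
    ((((Lp.memLp Y).mono_exponent hq).integrable le_rfl).abs).mul_of_top_right (Lp.memLp X)
  have hnn : ∀ n, ∀ᵐ ω ∂P, 0 ≤ y (b n) ω :=
    fun n => (Lp.coeFn_nonneg _).2 (hglb.1 ⟨b n, rfl⟩)
  have hI : Tendsto (fun n => ∫ ω, y (b n) ω * |Y ω| ∂P) atTop (nhds 0) := by
    have := tendsto_integral_of_dominated_convergence (F := fun n ω => y (b n) ω * |Y ω|)
      (f := fun _ => (0 : ℝ)) (μ := P) (fun ω => y (b 0) ω * |Y ω|)
      (fun n => (hint _).aestronglyMeasurable) (hint _) ?_ ?_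
    · simpa using this
    · intro n
      filter_upwards [hnn n, (Lp.coeFn_le _ _).2 (hy (hb n.zero_le))] with ω h1 h2
      rw [Real.norm_of_nonneg (mul_nonneg h1 (abs_nonneg _))]
      exact mul_le_mul_of_nonneg_right h2 (abs_nonneg _)
    · filter_upwards [hlim] with ω hω
      simpa using hω.mul_const |Y ω|
  rw [Metric.tendsto_nhds]
  intro ε hε
  obtain ⟨n, hn⟩ := (hI.eventually (gt_mem_nhds hε)).exists
  obtain ⟨i₀, hi₀⟩ := hdom (b n)
  filter_upwards [eventually_ge_atTop i₀] with i hi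
  refine lt_of_le_of_lt ?_ hn
  rw [Real.dist_eq, ← integral_sub (integrable_mul_of_Lp_top hq _ _)
    (integrable_mul_of_Lp_top hq _ _), ← Real.norm_eq_abs]
  refine norm_integral_le_of_norm_le (hint _) ?_
  filter_upwards [(Lp.coeFn_le _ _).2 (hi₀ i hi), Lp.coeFn_abs (x i - a), Lp.coeFn_sub (x i) a]
    with ω h1 h2 h3
  rw [h2, h3] at h1
  rw [← sub_mul, norm_mul, Real.norm_eq_abs, Real.norm_eq_abs]
  exact mul_le_mul_of_nonneg_right h1 (abs_nonneg _)

theorem WeakLowerSemicontinuous.fatouProperty [IsFiniteMeasure P] {q : ℝ≥0∞} (hq : 1 ≤ q)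
    {ρ : Lp ℝ ∞ P → EReal} (h : WeakLowerSemicontinuous P q ρ) : FatouProperty.{u, v} ρ := by
  intro ι _ _ _ x a hx
  refine le_liminf_of_forall_real_lt fun r hr => ?_
  have ht : Tendsto x atTop (@nhds _ (weakTopology P q) a) := by
    rw [weakTopology, nhds_iInf, tendsto_iInf]
    intro Y
    rw [nhds_induced, tendsto_comap_iff]
    exact hx.tendsto_integral_mul hq Y
  exact ht.eventually (h a r hr)

theorem weakTopology_le [IsFiniteMeasure P] {p q : ℝ≥0∞} (hpq : p ≤ q) :
    weakTopology P p ≤ weakTopology P q := by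
  refine le_iInf fun Y => ?_
  have hY : MemLp Y p P := (Lp.memLp Y).mono_exponent hpq
  refine (iInf_le _ (hY.toLp Y)).trans (le_of_eq ?_)
  congr 1
  funext X
  refine integral_congr_ae ?_
  filter_upwards [hY.coeFn_toLp] with ω hω
  rw [hω]

theorem WeakLowerSemicontinuous.mono [IsFiniteMeasure P] {p q : ℝ≥0∞} (hpq : p ≤ q)
    {ρ : Lp ℝ ∞ P → EReal} (h : WeakLowerSemicontinuous P q ρ) :
    WeakLowerSemicontinuous P p ρ := by
  unfold WeakLowerSemicontinuous at h ⊢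
  rw [@lowerSemicontinuous_iff_isClosed_preimage _ (weakTopology P q)] at h
  rw [@lowerSemicontinuous_iff_isClosed_preimage _ (weakTopology P p)]
  exact fun r => IsClosed.mono (h r) (weakTopology_le hpq)

end Lebesgue

/-! ### Separation in `L^1` and weak lower semicontinuity -/

section Duality

variable {Ω : Type u} [MeasurableSpace Ω] {P : Measure Ω}

/-- The inclusion of `L^q` into `L^p` over a finite measure, for `p ≤ q`. -/
noncomputable def lpInclusion [IsFiniteMeasure P] {p q : ℝ≥0∞} (hpq : p ≤ q) :
    Lp ℝ q P →ₗ[ℝ] Lp ℝ p P where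
  toFun X := ((Lp.memLp X).mono_exponent hpq).toLp X
  map_add' X Y := by
    rw [← MemLp.toLp_add]
    exact MemLp.toLp_congr _ _ (Lp.coeFn_add X Y)
  map_smul' c X := by
    rw [RingHom.id_apply, ← MemLp.toLp_const_smul]
    exact MemLp.toLp_congr _ _ (Lp.coeFn_smul c X)

theorem coeFn_lpInclusion [IsFiniteMeasure P] {p q : ℝ≥0∞} (hpq : p ≤ q) (X : Lp ℝ q P) :
    lpInclusion hpq X =ᵐ[P] X :=
  ((Lp.memLp X).mono_exponent hpq).coeFn_toLp

theorem norm_lpInclusion_le [IsProbabilityMeasure P] {p q : ℝ≥0∞} (hpq : p ≤ q)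
    (X : Lp ℝ q P) : ‖lpInclusion hpq X‖ ≤ ‖X‖ := by
  rw [Lp.norm_def, Lp.norm_def, eLpNorm_congr_ae (coeFn_lpInclusion hpq X)]
  exact ENNReal.toReal_mono (Lp.eLpNorm_ne_top X)
    (eLpNorm_le_eLpNorm_of_exponent_le hpq (Lp.aestronglyMeasurable X))

/-- A continuous functional on `L^1` of a probability space is bounded by a multiple of the
`L^1` norm on `L^2`, hence is represented there by a bounded random variable. -/
theorem exists_Lp_top_eq_integral [IsProbabilityMeasure P] (f : StrongDual ℝ (Lp ℝ 1 P)) :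
    ∃ Y : Lp ℝ ∞ P, ∀ X : Lp ℝ ∞ P,
      f (lpInclusion le_top X) = ∫ ω, X ω * Y ω ∂P := by
  let j : Lp ℝ 2 P →L[ℝ] Lp ℝ 1 P := (lpInclusion one_le_two).mkContinuous 1 fun X => by
    rw [one_mul]
    exact norm_lpInclusion_le one_le_two X
  let Y : Lp ℝ 2 P := (InnerProductSpace.toDual ℝ (Lp ℝ 2 P)).symm (f.comp j)
  have hY : ∀ Z : Lp ℝ 2 P, f (j Z) = inner ℝ Y Z := fun Z =>
    (InnerProductSpace.toDual_symm_apply (𝕜 := ℝ) (x := Z) (y := f.comp j)).symm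
  have hYint : Integrable Y P := (Lp.memLp Y).integrable one_le_two
  -- Testing `f` on indicators bounds the averages of `Y` over every set by `‖f‖`, so `|Y| ≤ ‖f‖`
  -- almost surely.
  have hs : ∀ s, MeasurableSet s → |∫ ω in s, Y ω ∂P| ≤ ∫ _ in s, ‖f‖ ∂P := by
    intro s hs
    have h1 : j (indicatorConstLp 2 hs (measure_ne_top P s) (1 : ℝ)) =
        indicatorConstLp 1 hs (measure_ne_top P s) (1 : ℝ) := by
      refine Lp.ext ((coeFn_lpInclusion one_le_two _).trans ?_)
      exact indicatorConstLp_coeFn.trans indicatorConstLp_coeFn.symm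
    have h2 := hY (indicatorConstLp 2 hs (measure_ne_top P s) (1 : ℝ))
    rw [real_inner_comm, L2.inner_indicatorConstLp_one, h1] at h2
    rw [← h2, ← Real.norm_eq_abs]
    refine (f.le_opNorm _).trans (le_of_eq ?_)
    rw [norm_indicatorConstLp one_ne_zero ENNReal.one_ne_top, setIntegral_const]
    simp [mul_comm]
  have hle : ∀ᵐ ω ∂P, Y ω ≤ ‖f‖ :=
    ae_le_of_forall_setIntegral_le hYint (integrable_const _)
      fun s h _ => (le_abs_self _).trans (hs s h)
  have hge : ∀ᵐ ω ∂P, -Y ω ≤ ‖f‖ := by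
    refine ae_le_of_forall_setIntegral_le hYint.neg (integrable_const _) fun s h _ => ?_
    simp only [integral_neg]
    exact (neg_le_abs _).trans (hs s h)
  have hYtop : MemLp Y ∞ P := by
    refine memLp_top_of_bound (Lp.aestronglyMeasurable Y) ‖f‖ ?_
    filter_upwards [hle, hge] with ω h1 h2
    exact abs_le'.2 ⟨h1, h2⟩
  refine ⟨hYtop.toLp Y, fun X => ?_⟩
  have hX : j (lpInclusion le_top X) = lpInclusion le_top X := by
    refine Lp.ext ((coeFn_lpInclusion one_le_two _).trans ?_)
    exact (coeFn_lpInclusion le_top X).trans (coeFn_lpInclusion le_top X).symm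
  rw [← hX, hY, L2.inner_def]
  refine integral_congr_ae ?_
  filter_upwards [coeFn_lpInclusion (p := 2) le_top X, hYtop.coeFn_toLp] with ω h1 h2
  rw [h1, h2]
  rfl

/-- A convex subset of `L^∞` that is relatively closed in `L^1` is `σ(L^∞, L^∞)`-closed. -/
theorem isClosed_weakTopology_of_convex [IsProbabilityMeasure P] {C : Set (Lp ℝ ∞ P)}
    (hC : Convex ℝ C)
    (hcl : ∀ X : Lp ℝ ∞ P, lpInclusion le_top X ∈
      closure ((lpInclusion (p := 1) le_top : Lp ℝ ∞ P →ₗ[ℝ] Lp ℝ 1 P) '' C) → X ∈ C) :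
    @IsClosed _ (weakTopology P ∞) C := by
  let _ := weakTopology P ∞
  rw [← isOpen_compl_iff, isOpen_iff_mem_nhds]
  intro X hX
  obtain ⟨f, r, hf, hr⟩ := geometric_hahn_banach_closed_point
    (hC.linear_image _).closure isClosed_closure (fun h => hX (hcl X h))
  obtain ⟨Y, hY⟩ := exists_Lp_top_eq_integral f
  have hcont : Continuous fun Z : Lp ℝ ∞ P => ∫ ω, Z ω * Y ω ∂P :=
    continuous_iff_le_induced.2 (iInf_le _ Y)
  have hlt : r < ∫ ω, X ω * Y ω ∂P := hY X ▸ hr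
  filter_upwards [hcont.continuousAt.eventually (lt_mem_nhds hlt)] with Z hZ hZC
  have := hf _ (subset_closure (Set.mem_image_of_mem _ hZC))
  rw [hY] at this
  exact lt_asymm this hZ

theorem FatouProperty.weakLowerSemicontinuous [IsProbabilityMeasure P] {ρ : Lp ℝ ∞ P → EReal}
    (hq : QuasiconvexOn ℝ Set.univ ρ) (hs : SurplusInvariant ρ) (ha : Antitone ρ)
    (h : FatouProperty.{u, v} ρ) : WeakLowerSemicontinuous P ∞ ρ := by
  unfold WeakLowerSemicontinuous
  rw [@lowerSemicontinuous_iff_isClosed_preimage _ (weakTopology P ∞)]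
  intro r
  refine isClosed_weakTopology_of_convex (by simpa [Set.preimage] using hq r) fun X hX => ?_
  obtain ⟨Z, hZ, hlim⟩ := mem_closure_iff_seq_limit.1 hX
  choose W hW hWZ using hZ
  obtain ⟨φ, -, hφ⟩ := (tendstoInMeasure_of_tendsto_Lp hlim).exists_seq_tendsto_ae
  -- The `W (φ n)` need not be dominated in `L^∞`; the truncations differ from `-X⁻` by at most
  -- `X⁻`.
  have hord := orderTendsto_of_tendsto_ae.{u, v}
    (x := fun n => -((W (φ n))⁻ ⊓ X⁻)) (a := -X⁻) (w := X⁻)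
    (fun n => (abs_neg_negPart_inf_sub_le _ _).trans inf_le_right) ?_
  · refine (Set.mem_preimage.2 (Set.mem_Iic.2 ?_))
    rw [hs X]
    refine (h _ _ _ hord).trans ?_
    refine (liminf_le_liminf (Eventually.of_forall fun i : ULift.{v} ℕ =>
      (hs.le_of_antitone ha (W (φ i.down)) X⁻).trans (hW _))).trans ?_
    exact liminf_const r |>.le
  · have hW' : ∀ᵐ ω ∂P, ∀ n, Z n ω = W n ω := by
      refine ae_all_iff.2 fun n => ?_
      rw [← hWZ n]
      exact coeFn_lpInclusion le_top (W n)
    have hle : ∀ᵐ ω ∂P, ∀ n, |(-((W (φ n))⁻ ⊓ X⁻)) ω - (-X⁻) ω| ≤ |W (φ n) ω - X ω| := by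
      refine ae_all_iff.2 fun n => ?_
      filter_upwards [(Lp.coeFn_le _ _).2
        ((abs_neg_negPart_inf_sub_le (W (φ n)) X).trans inf_le_left),
        Lp.coeFn_abs (-((W (φ n))⁻ ⊓ X⁻) - -X⁻), Lp.coeFn_sub (-((W (φ n))⁻ ⊓ X⁻)) (-X⁻),
        Lp.coeFn_abs (W (φ n) - X), Lp.coeFn_sub (W (φ n)) X] with ω h1 h2 h3 h4 h5
      rwa [h2, h3, h4, h5] at h1
    filter_upwards [hφ, hW', hle, coeFn_lpInclusion (p := 1) le_top X] with ω h1 h2 h3 h4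
    rw [tendsto_iff_dist_tendsto_zero] at h1 ⊢
    refine squeeze_zero (fun n => dist_nonneg) (fun n => ?_) h1
    rw [h2, h4]
    exact h3 n

theorem continuous_add_const_weakTopology [IsFiniteMeasure P] {q : ℝ≥0∞} (hq : 1 ≤ q)
    (c : Lp ℝ ∞ P) :
    @Continuous _ _ (weakTopology P q) (weakTopology P q) fun X => X + c := by
  refine continuous_iInf_rng.2 fun Y => continuous_induced_rng.2 ?_
  have heq : ((fun X : Lp ℝ ∞ P => ∫ ω, X ω * Y ω ∂P) ∘ fun X => X + c) =
      fun X => (∫ ω, X ω * Y ω ∂P) + ∫ ω, c ω * Y ω ∂P := by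
    funext X
    rw [Function.comp_apply, ← integral_add (integrable_mul_of_Lp_top hq _ _)
      (integrable_mul_of_Lp_top hq _ _)]
    refine integral_congr_ae ?_
    filter_upwards [Lp.coeFn_add X c] with ω hω
    rw [hω, Pi.add_apply, add_mul]
  rw [heq]
  let _ := weakTopology P q
  have : Continuous fun X : Lp ℝ ∞ P => ∫ ω, X ω * Y ω ∂P :=
    continuous_iff_le_induced.2 (iInf_le _ Y)
  exact this.add continuous_const

theorem SAdditive.weakLowerSemicontinuous [IsFiniteMeasure P] {q : ℝ≥0∞} (hq : 1 ≤ q)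
    {S : Lp ℝ ∞ P} {ρ : Lp ℝ ∞ P → EReal} (h : SAdditive S ρ)
    (hw : WeakLowerSemicontinuous P q (ρ ⊔ 0)) : WeakLowerSemicontinuous P q ρ := by
  intro X c hc
  obtain ⟨r, hcr, hrX⟩ := EReal.lt_iff_exists_real_btwn.1 hc
  have hcont := continuous_add_const_weakTopology hq (P := P) (r • S)
  let _ := weakTopology P q
  filter_upwards [hcont.continuousAt.eventually (hw _ _ ((h.lt_iff X r).1 hrX))] with Z hZ
  exact hcr.trans ((h.lt_iff Z r).2 hZ)

theorem smul_nonneg_Lp {q : ℝ≥0∞} {S : Lp ℝ q P} (hS : 0 ≤ S) {m : ℝ} (hm : 0 ≤ m) :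
    0 ≤ m • S := by
  rw [← Lp.coeFn_nonneg] at hS ⊢
  filter_upwards [hS, Lp.coeFn_smul m S] with ω h1 h2
  rw [h2]
  exact mul_nonneg hm h1

end Duality

end RiskFunctional

theorem mainTheorem7 {Ω : Type u} [MeasurableSpace Ω] (P : Measure Ω) [IsProbabilityMeasure P]
    (ρ : Lp ℝ ∞ P → EReal) (hbot : ∀ X, ρ X ≠ ⊥)
    (hρ :
      (QuasiconvexOn ℝ Set.univ ρ ∧ RiskFunctional.SurplusInvariant ρ ∧ Antitone ρ) ∨
      (RiskFunctional.IsConvex ρ ∧ RiskFunctional.SurplusInvariantSubjectToPositivity ρ ∧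
        Antitone ρ ∧ ∃ S : Lp ℝ ∞ P, 0 ≤ S ∧ S ≠ 0 ∧ RiskFunctional.SAdditive S ρ)) :
    List.TFAE [
      RiskFunctional.FatouProperty.{u, v} ρ,
      RiskFunctional.SuperFatouProperty.{u, v} ρ,
      RiskFunctional.WeakLowerSemicontinuous P 1 ρ,
      RiskFunctional.WeakLowerSemicontinuous P ∞ ρ] := by
  tfae_have 2 → 1 := fun h => h.fatouProperty
  tfae_have 4 → 3 := fun h => h.mono le_top
  tfae_have 3 → 1 := fun h => h.fatouProperty le_rfl
  tfae_have 1 → 2 := by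
    intro h
    rcases hρ with ⟨-, hs, ha⟩ | ⟨-, hs, ha, S, hS, -, hadd⟩
    · exact h.superFatouProperty hs ha
    · exact hadd.superFatouProperty (h.sup_zero.superFatouProperty
        (hs.surplusInvariant_sup_zero ha hbot (fun _ hm => RiskFunctional.smul_nonneg_Lp hS hm) hadd)
        (ha.sup antitone_const))
  tfae_have 1 → 4 := by
    intro h
    rcases hρ with ⟨hq, hs, ha⟩ | ⟨hc, hs, ha, S, hS, -, hadd⟩
    · exact h.weakLowerSemicontinuous hq hs ha
    · exact hadd.weakLowerSemicontinuous le_top (h.sup_zero.weakLowerSemicontinuous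
        (RiskFunctional.quasiconvexOn_sup_zero (hc.quasiconvexOn hbot))
        (hs.surplusInvariant_sup_zero ha hbot (fun _ hm => RiskFunctional.smul_nonneg_Lp hS hm) hadd)
        (ha.sup antitone_const))
  tfae_finish
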